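/- For an $n\times n$ complex matrix $A=(a_{jk})$ put $p_A(z_1,\dots,z_n)=\sum_{j,k=1}^n a_{jk}z_jz_k$ and $\|p_A\|_{\mathbb D^n,\infty}=\sup\{|p_A(z)|: z\in\mathbb C^n,\ |z_j|<1 \text{ for all } j\}$; for an $n$-tuple $\boldsymbol T=(T_1,\dots,T_n)$ of bounded operators put $p_A(\boldsymbol T)=\sum_{j,k=1}^n a_{jk}T_jT_k$. Let $$C_2^+(n)=\sup\frac{\|p_A(\boldsymbol T)\|}{\|p_A\|_{\mathbb D^n,\infty}},$$ where the supremum is over all nonzero non-negative definite complex $n\times n$ matrices $A$ and all $n$-tuples $\boldsymbol T$ of pairwise commuting contractions on a complex Hilbert space. Let the real positive Grothendieck constant $K_G^+(\mathbb R)$ be the least $K>0$ such that $$\Big|\sum_{j,k=1}^n a_{jk}\langle x_j,y_k\rangle\Big|\le K\,\sup\Big\{\Big|\sum_{j,k=1}^n a_{jk}v_kw_j\Big| : v,w\in[-1,1]^n\Big\}$$ for all $n\in\mathbb N$, all real symmetric non-negative definite $n\times n$ matrices $A=(a_{jk})$, and all unit vectors $x_1,\dots,x_n,y_1,\dots,y_n$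 in a real Hilbert space. Then $C_2^+(n)$ is finite for every $n$, the limit $\lim_{n\to\infty}C_2^+(n)$ exists, the least constant $K_G^+(\mathbb R)$ exists, and $$\lim_{n\to\infty}C_2^+(n)=\frac{\pi}{2}=K_G^+(\mathbb R).$$ -/

import Mathlib

open Filter Topology
open scoped ComplexOrder

universe u v

noncomputable section

/-- The homogeneous quadratic polynomial `p_A(x₁, …, xₙ) = ∑ⱼₖ aⱼₖ xⱼ xₖ` of a complex `n × n`
matrix `A`, evaluated at an `n`-tuple of elements of a complex algebra (complex numbers, or
bounded operators on a Hilbert space). -/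
def quadPoly {n : ℕ} (A : Matrix (Fin n) (Fin n) ℂ) {R : Type*} [Ring R] [Algebra ℂ R]
    (x : Fin n → R) : R :=
  ∑ j, ∑ k, A j k • (x j * x k)

/-- The supremum norm of `p_A` over the unit polydisc `𝔻ⁿ`. -/
def polydiscNorm {n : ℕ} (A : Matrix (Fin n) (Fin n) ℂ) : ℝ :=
  sSup {r : ℝ | ∃ z : Fin n → ℂ, (∀ j, ‖z j‖ < 1) ∧ r = ‖quadPoly A z‖}

/-- `T` is an `n`-tuple of pairwise commuting contractions. -/
def IsCommutingContractions {n : ℕ} {H : Type*} [NormedAddCommGroup H] [InnerProductSpace ℂ H]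
    (T : Fin n → H →L[ℂ] H) : Prop :=
  (∀ j, ‖T j‖ ≤ 1) ∧ ∀ j k, T j * T k = T k * T j

/-- The quotients `‖p_A(T)‖ / ‖p_A‖`, where `A ≠ 0` is a complex non-negative definite `n × n`
matrix and `T` is an `n`-tuple of commuting contractions on some complex Hilbert space. -/
def C2PlusQuotients (n : ℕ) : Set ℝ :=
  {r : ℝ | ∃ A : Matrix (Fin n) (Fin n) ℂ, A ≠ 0 ∧ A.PosSemidef ∧
    ∃ (H : Type u) (_ : NormedAddCommGroup H) (_ : InnerProductSpace ℂ H) (_ : CompleteSpace H)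
      (T : Fin n → H →L[ℂ] H),
      IsCommutingContractions T ∧ r = ‖quadPoly A T‖ / polydiscNorm A}

/-- The constant `C₂⁺(n)`. -/
def C2Plus (n : ℕ) : ℝ := sSup (C2PlusQuotients.{u} n)

/-- The norm `‖A‖_{∞ → 1}` of a real `n × n` matrix, the supremum of `|⟨A v, w⟩|` over `v`, `w` in
the unit ball of `ℓ^∞` (the norm of `Fin n → ℝ` is the maximum norm). -/
def inftyOneNorm {n : ℕ} (A : Matrix (Fin n) (Fin n) ℝ) : ℝ :=
  sSup {r : ℝ | ∃ v w : Fin n → ℝ, ‖v‖ ≤ 1 ∧ ‖w‖ ≤ 1 ∧ r = |(A.mulVec v) ⬝ᵥ w|}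

/-- The constants `K > 0` for which the Grothendieck inequality holds for all real (symmetric)
non-negative definite matrices of every size and all unit vectors of all real Hilbert spaces. The
real positive Grothendieck constant is the least element of this set. -/
def positiveGrothendieckBounds : Set ℝ :=
  {K : ℝ | 0 < K ∧ ∀ (n : ℕ) (A : Matrix (Fin n) (Fin n) ℝ), A.PosSemidef →
    ∀ (H : Type v) [NormedAddCommGroup H] [InnerProductSpace ℝ H] [CompleteSpace H]
      (x y : Fin n → H), (∀ j, ‖x j‖ = 1) → (∀ k, ‖y k‖ = 1) →
      |∑ j, ∑ k, A j k * inner ℝ (x j) (y k)| ≤ K * inftyOneNorm A}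

end

namespace PositiveGrothendieck

open MeasureTheory ProbabilityTheory
open scoped RealInnerProductSpace

/-! Upper bound (Rietz). Let the form of a real positive `A` be at most `B` on the cube, let `g` be
standard Gaussian, `c = √(2/π)` and `s_j` the sign of `⟪x_j, g⟫`. Since `‖x_j‖ E[s_j ⟪y, g⟫] = c
⟪x_j, y⟫`, taking means in the positivity of the form at `‖x_j‖ s_j - c ⟪x_j, g⟫` yields `c² ∑ a_jk
⟪x_j, x_k⟫ ≤ B`. Positivity at `x - y` passes to two families of vectors. For commuting `T` only the
real part of `A` matters, and `⟪p_A(T) x, y⟫` is a form in the vectors `T_k x` and `T_j* y`, so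
`π/2` bounds both constants.

Optimality. Take the kernel `⟪g, h⟫` over Gaussian vectors of `ℝ^d`. Its form at `|f| ≤ 1` is
`‖E[f(g) g]‖² ≤ 2/π`, whereas at the unit vectors `g/‖g‖` it is at least `(E‖g‖)²/d`, which tends to
`1`. A discretisation turns the kernel into finite matrices (`exists_matrix_lt_sum_mul_inner`).
Varopoulos' commuting contractions, whose products are `⟪x_j, x_k⟫` times one fixed operator, carry
the example over to `C2Plus`. -/

theorem integral_abs_gaussianReal :
    ∫ x, |x| ∂gaussianReal 0 1 = √(2 / Real.pi) := by
  have h : ∫ x in Set.Ioi (0 : ℝ), x * Real.exp (-(x ^ 2) / 2) = 1 := by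
    have := integral_rpow_mul_exp_neg_mul_rpow (p := 2) (q := 1) (b := 1 / 2)
      (by norm_num) (by norm_num) (by norm_num)
    rw [show ((1 : ℝ) + 1) / 2 = 1 by norm_num, show -((1 : ℝ) + 1) / 2 = -1 by norm_num,
      Real.Gamma_one, Real.rpow_neg_one] at this
    convert! this using 1
    · refine setIntegral_congr_fun measurableSet_Ioi fun x _ ↦ ?_
      simp only [Real.rpow_one, Real.rpow_two]
      ring_nf
    · norm_num
  rw [integral_gaussianReal_eq_integral_smul one_ne_zero]
  have h2 : ∀ x : ℝ, gaussianPDFReal 0 1 x • |x| =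
      (√(2 * Real.pi))⁻¹ * (|x| * Real.exp (-(|x| ^ 2) / 2)) := by
    intro x
    simp [gaussianPDFReal, smul_eq_mul]
    ring
  simp_rw [h2]
  rw [integral_const_mul, integral_comp_abs (f := fun x ↦ x * Real.exp (-(x ^ 2) / 2)), h]
  rw [Real.sqrt_mul (by norm_num), Real.sqrt_div (by norm_num)]
  have h3 : √2 * √2 = 2 := Real.mul_self_sqrt (by norm_num)
  have h4 : 0 < √Real.pi := Real.sqrt_pos.2 Real.pi_pos
  field_simp
  linarith

/-! ### Gaussian functionals and their signs -/

section

variable {E : Type*} [NormedAddCommGroup E] [InnerProductSpace ℝ E] [FiniteDimensional ℝ E]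
  [MeasurableSpace E] [BorelSpace E]

theorem memLp_inner_stdGaussian (x : E) : MemLp (fun g ↦ ⟪x, g⟫) 2 (stdGaussian E) :=
  (IsGaussian.memLp_two_id (μ := stdGaussian E)).const_inner x

theorem integrable_inner_stdGaussian (x : E) : Integrable (fun g ↦ ⟪x, g⟫) (stdGaussian E) :=
  (memLp_inner_stdGaussian x).integrable (by norm_num)

theorem integrable_inner_mul_inner_stdGaussian (x y : E) :
    Integrable (fun g ↦ ⟪x, g⟫ * ⟪y, g⟫) (stdGaussian E) :=
  (memLp_inner_stdGaussian x).integrable_mul (memLp_inner_stdGaussian y)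

theorem integral_inner_mul_inner_stdGaussian (x y : E) :
    ∫ g, ⟪x, g⟫ * ⟪y, g⟫ ∂stdGaussian E = ⟪x, y⟫ := by
  have h := covarianceBilin_apply (IsGaussian.memLp_two_id (μ := stdGaussian E)) x y
  have h0 : ∫ x, id x ∂(stdGaussian E) = 0 := integral_id_stdGaussian
  simpa [covarianceBilin_stdGaussian, h0, innerSL_apply_apply ℝ] using h.symm

theorem integral_abs_inner_stdGaussian (x : E) (hx : ‖x‖ = 1) :
    ∫ g, |⟪x, g⟫| ∂stdGaussian E = √(2 / Real.pi) := by
  have h : (stdGaussian E).map (innerSL ℝ x) = gaussianReal 0 1 := by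
    rw [IsGaussian.map_eq_gaussianReal, integral_strongDual_stdGaussian, variance_dual_stdGaussian]
    simp [hx]
  rw [← integral_abs_gaussianReal, ← h, integral_map (by fun_prop) (by fun_prop)]
  simp

/-- The sign of a real number, with the value `1` at `0`. -/
noncomputable def signOne (t : ℝ) : ℝ := if 0 ≤ t then 1 else -1

theorem measurable_signOne : Measurable signOne :=
  Measurable.ite measurableSet_Ici measurable_const measurable_const

theorem abs_signOne (t : ℝ) : |signOne t| = 1 := by
  unfold signOne; split_ifs <;> simp

theorem signOne_mul_self (t : ℝ) : signOne t * t = |t| := by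
  unfold signOne
  split_ifs with h
  · simp [abs_of_nonneg h]
  · simp [abs_of_neg (not_le.1 h)]

theorem signOne_mul (r t : ℝ) (hr : 0 < r) : signOne (r * t) = signOne t := by
  simp [signOne, hr]

theorem integrable_signOne_inner_mul {f : E → ℝ} (x : E) (hf : Integrable f (stdGaussian E)) :
    Integrable (fun g ↦ signOne ⟪x, g⟫ * f g) (stdGaussian E) := by
  refine hf.bdd_mul (c := 1) ?_ (.of_forall fun g ↦ ?_)
  · exact (measurable_signOne.comp (by fun_prop)).aestronglyMeasurable
  · rw [Real.norm_eq_abs, abs_signOne]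

/-- A reflection argument: the sign of `⟪x, g⟫` is uncorrelated to `⟪y, g⟫` if `x ⟂ y`. -/
theorem integral_signOne_inner_mul_inner_of_orthogonal (x y : E) (h : ⟪x, y⟫ = 0) :
    ∫ g, signOne ⟪x, g⟫ * ⟪y, g⟫ ∂stdGaussian E = 0 := by
  let R := (Submodule.span ℝ {x}).reflection
  have hmap := stdGaussian_map (E := E) R
  have hx : R x = x := Submodule.reflection_mem_subspace_eq_self (Submodule.mem_span_singleton_self x)
  have hy : R y = -y :=
    Submodule.reflection_mem_subspace_orthogonalComplement_eq_neg
      (Submodule.mem_orthogonal_singleton_iff_inner_right.2 h)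
  have hR (u g : E) : ⟪u, R g⟫ = ⟪R u, g⟫ := by
    rw [← R.inner_map_map u (R g)]
    congr 1
    exact Submodule.reflection_reflection _ g
  have hmeas : Measurable fun g : E ↦ signOne ⟪x, g⟫ * ⟪y, g⟫ :=
    (measurable_signOne.comp (by fun_prop)).mul (by fun_prop)
  have key : ∫ g, signOne ⟪x, g⟫ * ⟪y, g⟫ ∂stdGaussian E =
      ∫ g, -(signOne ⟪x, g⟫ * ⟪y, g⟫) ∂stdGaussian E := by
    conv_lhs => rw [← hmap]
    rw [integral_map R.continuous.aemeasurable hmeas.aestronglyMeasurable]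
    simp_rw [hR, hx, hy, inner_neg_left, mul_neg]
  rw [integral_neg] at key
  linarith

/-- Split `y` along the direction of `x`: the orthogonal part contributes nothing, the parallel part
a first absolute moment. The factor `‖x‖` admits `x = 0`. -/
theorem norm_mul_integral_signOne_inner_mul_inner (x y : E) :
    ‖x‖ * ∫ g, signOne ⟪x, g⟫ * ⟪y, g⟫ ∂stdGaussian E = √(2 / Real.pi) * ⟪x, y⟫ := by
  rcases eq_or_ne x 0 with rfl | hx
  · simp
  have hx' : 0 < ‖x‖ := norm_pos_iff.2 hx
  obtain ⟨u, hu1, hxu⟩ : ∃ u : E, ‖u‖ = 1 ∧ x = ‖x‖ • u :=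
    ⟨‖x‖⁻¹ • x, by simp [norm_smul, hx'.ne'], by simp [smul_smul, hx'.ne']⟩
  have hs (g : E) : signOne ⟪x, g⟫ = signOne ⟪u, g⟫ := by
    conv_lhs => rw [hxu, real_inner_smul_left, signOne_mul _ _ hx']
  simp_rw [hs]
  set z : E := y - ⟪u, y⟫ • u with hz
  have huz : ⟪u, z⟫ = 0 := by
    simp [hz, inner_sub_right, real_inner_smul_right, hu1]
  have hsplit (g : E) : signOne ⟪u, g⟫ * ⟪y, g⟫ =
      ⟪u, y⟫ * |⟪u, g⟫| + signOne ⟪u, g⟫ * ⟪z, g⟫ := by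
    have : ⟪z, g⟫ = ⟪y, g⟫ - ⟪u, y⟫ * ⟪u, g⟫ := by rw [hz, inner_sub_left, real_inner_smul_left]
    rw [this, ← signOne_mul_self]
    ring
  simp_rw [hsplit]
  rw [integral_add ((integrable_inner_stdGaussian u).abs.const_mul _)
    (integrable_signOne_inner_mul u (integrable_inner_stdGaussian z)), integral_const_mul,
    integral_abs_inner_stdGaussian u hu1,
    integral_signOne_inner_mul_inner_of_orthogonal u z huz]
  conv_rhs => rw [hxu, real_inner_smul_left]
  ring

end

/-! ### The mean norm of a Gaussian vector -/

theorem memLp_sq_gaussianReal : MemLp (fun x : ℝ ↦ x ^ 2) 2 (gaussianReal 0 1) := by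
  have h := memLp_id_gaussianReal' (μ := 0) (v := 1) 4 (by norm_num)
  rw [memLp_two_iff_integrable_sq (by fun_prop)]
  have h2 := h.integrable_norm_pow (p := 4) (by norm_num)
  refine h2.congr (.of_forall fun x ↦ ?_)
  simp only [id, Real.norm_eq_abs]
  rw [← pow_mul, Even.pow_abs (by decide)]

theorem integral_sq_gaussianReal : ∫ x, x ^ 2 ∂gaussianReal 0 1 = 1 := by
  have h := variance_fun_id_gaussianReal (μ := 0) (v := 1)
  rw [variance_eq_integral (by fun_prop)] at h
  simpa [integral_id_gaussianReal] using h

/-- The difference of the two sides is `s (s - 1)² (s + 2) / 2`. A minorant of `s` quadratic in `s²`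
has a mean that needs only the mean and variance of `‖g‖²`. -/
theorem one_add_half_sub_half_sq_le (s : ℝ) (hs : 0 ≤ s) :
    1 + (s ^ 2 - 1) / 2 - (s ^ 2 - 1) ^ 2 / 2 ≤ s := by
  nlinarith [mul_nonneg hs (mul_nonneg (sq_nonneg (s - 1)) (by linarith : 0 ≤ s + 2))]

/-- The mean of the norm of a standard Gaussian vector in dimension `d` is `√d (1 - O(1/d))`. -/
theorem exists_le_integral_norm_stdGaussian : ∃ C : ℝ, ∀ (ι : Type u) [Fintype ι] [Nonempty ι],
    √(Fintype.card ι : ℝ) * (1 - C / (Fintype.card ι : ℝ)) ≤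
      ∫ g, ‖g‖ ∂stdGaussian (EuclideanSpace ℝ ι) := by
  -- As `‖g‖²` has mean `d` and variance `d V`, the minorant has mean `√d (1 - d V / (2 d²))`.
  refine ⟨Var[fun x : ℝ ↦ x ^ 2; gaussianReal 0 1] / 2, fun ι _ _ ↦ ?_⟩
  set V := Var[fun x : ℝ ↦ x ^ 2; gaussianReal 0 1]
  set d : ℝ := (Fintype.card ι : ℝ) with hd
  have hd0 : 0 < d := by simp [hd, Fintype.card_pos]
  set P : Measure (ι → ℝ) := Measure.pi fun _ : ι ↦ gaussianReal 0 1 with hP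
  have hmem (i : ι) : MemLp (fun x : ι → ℝ ↦ x i ^ 2) 2 P :=
    memLp_sq_gaussianReal.comp_measurePreserving
      (measurePreserving_eval (fun _ : ι ↦ gaussianReal 0 1) i)
  have hmemN : MemLp (fun x : ι → ℝ ↦ ∑ i, x i ^ 2) 2 P := memLp_finsetSum _ fun i _ ↦ hmem i
  have hint : Integrable (fun x : ι → ℝ ↦ ∑ i, x i ^ 2) P := hmemN.integrable (by norm_num)
  have hmean : ∫ x, ∑ i, x i ^ 2 ∂P = d := by
    rw [integral_finsetSum _ fun i _ ↦ (hmem i).integrable (by norm_num)]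
    have (i : ι) : ∫ x : ι → ℝ, x i ^ 2 ∂P = 1 := by
      rw [← integral_sq_gaussianReal,
        ← (measurePreserving_eval (fun _ : ι ↦ gaussianReal 0 1) i).map_eq,
        integral_map (measurable_pi_apply i).aemeasurable (by fun_prop)]
    simp [this, hd]
  have hvar : ∫ x, (∑ i, x i ^ 2 - d) ^ 2 ∂P = d * V := by
    have h := variance_sum_pi (μ := fun _ : ι ↦ gaussianReal 0 1) (X := fun _ x ↦ x ^ 2)
      (fun _ ↦ memLp_sq_gaussianReal)
    rw [variance_eq_integral (by fun_prop)] at h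
    simp only [Finset.sum_apply, Finset.sum_const, Finset.card_univ, nsmul_eq_mul] at h
    rw [← hP, hmean] at h
    exact h
  have hintsq : Integrable (fun x : ι → ℝ ↦ (∑ i, x i ^ 2 - d) ^ 2) P :=
    (hmemN.sub (memLp_const d)).integrable_sq
  rw [← map_pi_eq_stdGaussian, integral_map (by fun_prop) (by fun_prop)]
  have hnorm : Integrable (fun x : ι → ℝ ↦ ‖WithLp.toLp 2 x‖) P := by
    have := (IsGaussian.integrable_id (μ := stdGaussian (EuclideanSpace ℝ ι))).norm
    rw [← map_pi_eq_stdGaussian, integrable_map_measure (by fun_prop) (by fun_prop)] at this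
    exact this
  have hle (x : ι → ℝ) : √d * (1 + (∑ i, x i ^ 2 - d) / (2 * d) -
      (∑ i, x i ^ 2 - d) ^ 2 / (2 * d ^ 2)) ≤ ‖WithLp.toLp 2 x‖ := by
    have hN : ∑ i, x i ^ 2 = ‖WithLp.toLp 2 x‖ ^ 2 := by
      rw [EuclideanSpace.real_norm_sq_eq]
    have hs := one_add_half_sub_half_sq_le (‖WithLp.toLp 2 x‖ / √d) (by positivity)
    rw [div_pow, Real.sq_sqrt hd0.le, ← hN] at hs
    have hsd : 0 < √d := Real.sqrt_pos.2 hd0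
    rw [le_div_iff₀ hsd] at hs
    refine le_trans (le_of_eq ?_) hs
    field_simp
  have := integral_mono (μ := P) (f := fun x : ι → ℝ ↦ √d * (1 + (∑ i, x i ^ 2 - d) / (2 * d) -
      (∑ i, x i ^ 2 - d) ^ 2 / (2 * d ^ 2))) ?_ hnorm hle
  · refine le_trans (le_of_eq ?_) this
    rw [integral_const_mul, integral_sub, integral_add, integral_div, integral_div, hvar,
      integral_sub, hmean]
    · simp
      left
      field_simp
    all_goals fun_prop
  · exact (((integrable_const _).add ((hint.sub (integrable_const d)).div_const _)).sub
      (hintsq.div_const _)).const_mul _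

/-! ### Rietz's inequality -/

section

variable {m : Type*} [Fintype m] {A : Matrix m m ℝ} {B : ℝ}

/-- `B` bounds the quadratic form of `A` on the cube `[-1, 1]ᵐ`. -/
def IsCubeBound (A : Matrix m m ℝ) (B : ℝ) : Prop :=
  ∀ v : m → ℝ, (∀ j, |v j| ≤ 1) → ∑ j, ∑ k, A j k * (v j * v k) ≤ B

theorem _root_.Matrix.PosSemidef.sum_mul_nonneg (hA : A.PosSemidef) (v : m → ℝ) :
    0 ≤ ∑ j, ∑ k, A j k * (v j * v k) := by
  have h := hA.dotProduct_mulVec_nonneg v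
  refine h.trans_eq ?_
  simp only [dotProduct, Matrix.mulVec, Finset.mul_sum, star_trivial]
  exact Finset.sum_congr rfl fun j _ ↦ Finset.sum_congr rfl fun k _ ↦ by ring

theorem _root_.Matrix.PosSemidef.sum_mul_inner_nonneg {H : Type*} [NormedAddCommGroup H]
    [InnerProductSpace ℝ H] (hA : A.PosSemidef) (x : m → H) :
    0 ≤ ∑ j, ∑ k, A j k * ⟪x j, x k⟫ := by
  obtain ⟨N, v, rfl⟩ := Matrix.posSemidef_iff_eq_sum_vecMulVec.1 hA
  have h (i : Fin N) : ∑ j, ∑ k, v i j * v i k * ⟪x j, x k⟫ =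
      ⟪∑ j, v i j • x j, ∑ k, v i k • x k⟫ := by
    simp_rw [sum_inner, inner_sum, real_inner_smul_left, real_inner_smul_right, mul_assoc]
  calc (0 : ℝ) ≤ ∑ i, ∑ j, ∑ k, v i j * v i k * ⟪x j, x k⟫ :=
        Finset.sum_nonneg fun i _ ↦ by rw [h]; exact real_inner_self_nonneg
    _ = _ := by
        rw [Finset.sum_comm]
        refine Finset.sum_congr rfl fun j _ ↦ ?_
        rw [Finset.sum_comm]
        refine Finset.sum_congr rfl fun k _ ↦ ?_
        simp [Matrix.sum_apply, Matrix.vecMulVec_apply, Finset.sum_mul]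

theorem IsCubeBound.sum_mul_inner_self_le_of_finiteDimensional {E : Type*} [NormedAddCommGroup E]
    [InnerProductSpace ℝ E] [FiniteDimensional ℝ E] (hB : IsCubeBound A B) (hA : A.PosSemidef)
    (x : m → E) (hx : ∀ j, ‖x j‖ ≤ 1) :
    ∑ j, ∑ k, A j k * ⟪x j, x k⟫ ≤ Real.pi / 2 * B := by
  let _ : MeasurableSpace E := borel E
  have : BorelSpace E := ⟨rfl⟩
  set c := √(2 / Real.pi) with hc
  have hc2 : c * c = 2 / Real.pi := Real.mul_self_sqrt (by positivity)
  set s : m → E → ℝ := fun j g ↦ signOne ⟪x j, g⟫ with hs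
  -- With `a_j = ‖x_j‖ s_j` and `b_j = c ⟪x_j, g⟫`, this is `a_j a_k - (a_j - b_j)(a_k - b_k)`: the
  -- cube bound controls the first form, and positivity discards the second.
  set F : m → m → E → ℝ := fun j k g ↦ c * (‖x j‖ * (s j g * ⟪x k, g⟫)) +
    c * (‖x k‖ * (s k g * ⟪x j, g⟫)) - c * c * (⟪x j, g⟫ * ⟪x k, g⟫) with hF
  have i1 (j k : m) : Integrable (fun g ↦ c * (‖x j‖ * (s j g * ⟪x k, g⟫))) (stdGaussian E) :=
    ((integrable_signOne_inner_mul (x j) (integrable_inner_stdGaussian (x k))).const_mul _).const_mul _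
  have i2 (j k : m) : Integrable (fun g ↦ c * c * (⟪x j, g⟫ * ⟪x k, g⟫)) (stdGaussian E) :=
    (integrable_inner_mul_inner_stdGaussian (x j) (x k)).const_mul _
  have hFi (j k : m) : Integrable (F j k) (stdGaussian E) :=
    ((i1 j k).add (i1 k j)).sub (i2 j k)
  have hFint (j k : m) : ∫ g, F j k g ∂stdGaussian E = c * c * ⟪x j, x k⟫ := by
    change ∫ g, c * (‖x j‖ * (s j g * ⟪x k, g⟫)) + c * (‖x k‖ * (s k g * ⟪x j, g⟫)) -
      c * c * (⟪x j, g⟫ * ⟪x k, g⟫) ∂stdGaussian E = _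
    rw [integral_sub (by exact (i1 j k).add (i1 k j)) (i2 j k), integral_add (i1 j k) (i1 k j)]
    simp_rw [integral_const_mul, hs, norm_mul_integral_signOne_inner_mul_inner,
      integral_inner_mul_inner_stdGaussian, ← hc, real_inner_comm (x j) (x k)]
    ring
  have hpt (g : E) : ∑ j, ∑ k, A j k * F j k g ≤ B := by
    have h0 := hA.sum_mul_nonneg fun j ↦ ‖x j‖ * s j g - c * ⟪x j, g⟫
    have h1 := hB (fun j ↦ ‖x j‖ * s j g) fun j ↦ by
      rw [abs_mul, hs, abs_signOne, mul_one, abs_norm]; exact hx j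
    have h2 : ∑ j, ∑ k, A j k * F j k g = ∑ j, ∑ k, A j k * (‖x j‖ * s j g * (‖x k‖ * s k g)) -
        ∑ j, ∑ k, A j k * ((‖x j‖ * s j g - c * ⟪x j, g⟫) * (‖x k‖ * s k g - c * ⟪x k, g⟫)) := by
      simp_rw [← Finset.sum_sub_distrib, hF]
      exact Finset.sum_congr rfl fun j _ ↦ Finset.sum_congr rfl fun k _ ↦ by ring
    linarith
  have hI := integral_mono (μ := stdGaussian E)
    (integrable_finsetSum _ fun j _ ↦ integrable_finsetSum _ fun k _ ↦ (hFi j k).const_mul (A j k))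
    (integrable_const B) hpt
  rw [integral_finsetSum _ fun j _ ↦ integrable_finsetSum _ fun k _ ↦ (hFi j k).const_mul (A j k)]
    at hI
  simp_rw [integral_finsetSum _ fun k _ ↦ (hFi _ k).const_mul (A _ k), integral_const_mul, hFint,
    hc2] at hI
  simp only [integral_const, probReal_univ, one_smul] at hI
  have h3 : ∑ j, ∑ k, A j k * (2 / Real.pi * ⟪x j, x k⟫) =
      2 / Real.pi * ∑ j, ∑ k, A j k * ⟪x j, x k⟫ := by
    simp_rw [Finset.mul_sum]
    exact Finset.sum_congr rfl fun j _ ↦ Finset.sum_congr rfl fun k _ ↦ by ring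
  rw [h3] at hI
  have hpi := Real.pi_pos
  calc _ = Real.pi / 2 * (2 / Real.pi * ∑ j, ∑ k, A j k * ⟪x j, x k⟫) := by field_simp
    _ ≤ _ := by gcongr

/-- **Rietz's inequality**: the positive Grothendieck inequality with constant `π / 2`. -/
theorem IsCubeBound.sum_mul_inner_self_le {H : Type*} [NormedAddCommGroup H]
    [InnerProductSpace ℝ H] (hB : IsCubeBound A B) (hA : A.PosSemidef)
    (x : m → H) (hx : ∀ j, ‖x j‖ ≤ 1) :
    ∑ j, ∑ k, A j k * ⟪x j, x k⟫ ≤ Real.pi / 2 * B := by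
  -- The standard Gaussian measure needs finite dimension, and the span of the vectors suffices.
  have : FiniteDimensional ℝ (Submodule.span ℝ (Set.range x)) :=
    FiniteDimensional.span_of_finite ℝ (Set.finite_range x)
  exact hB.sum_mul_inner_self_le_of_finiteDimensional hA
    (fun j ↦ (⟨x j, Submodule.subset_span ⟨j, rfl⟩⟩ : Submodule.span ℝ (Set.range x))) hx

/-- Positivity at `x - y` bounds twice the mixed sum by the two diagonal ones. -/
theorem IsCubeBound.sum_mul_inner_le {H : Type*} [NormedAddCommGroup H]
    [InnerProductSpace ℝ H] (hB : IsCubeBound A B) (hA : A.PosSemidef)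
    (x y : m → H) (hx : ∀ j, ‖x j‖ ≤ 1) (hy : ∀ j, ‖y j‖ ≤ 1) :
    ∑ j, ∑ k, A j k * ⟪x j, y k⟫ ≤ Real.pi / 2 * B := by
  have h0 := hA.sum_mul_inner_nonneg fun j ↦ x j - y j
  have h1 := hB.sum_mul_inner_self_le hA x hx
  have h2 := hB.sum_mul_inner_self_le hA y hy
  have hsymm : ∑ j, ∑ k, A j k * ⟪y j, x k⟫ = ∑ j, ∑ k, A j k * ⟪x j, y k⟫ := by
    rw [Finset.sum_comm]
    refine Finset.sum_congr rfl fun j _ ↦ Finset.sum_congr rfl fun k _ ↦ ?_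
    rw [real_inner_comm, ← hA.isHermitian.apply j k, star_trivial]
  simp_rw [inner_sub_left, inner_sub_right, mul_sub, Finset.sum_sub_distrib] at h0
  linarith

theorem IsCubeBound.abs_sum_mul_inner_le {H : Type*} [NormedAddCommGroup H]
    [InnerProductSpace ℝ H] (hB : IsCubeBound A B) (hA : A.PosSemidef)
    (x y : m → H) (hx : ∀ j, ‖x j‖ ≤ 1) (hy : ∀ j, ‖y j‖ ≤ 1) :
    |∑ j, ∑ k, A j k * ⟪x j, y k⟫| ≤ Real.pi / 2 * B := by
  refine abs_le'.2 ⟨hB.sum_mul_inner_le hA x y hx hy, ?_⟩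
  have := hB.sum_mul_inner_le hA x (fun j ↦ -y j) hx (by simpa using hy)
  simpa using this

end

/-! ### The upper bound for both constants -/

variable {n : ℕ}

theorem mulVec_dotProduct (A : Matrix (Fin n) (Fin n) ℝ) (v w : Fin n → ℝ) :
    A.mulVec v ⬝ᵥ w = ∑ j, ∑ k, A j k * (w j * v k) := by
  simp only [dotProduct, Matrix.mulVec, Finset.sum_mul]
  exact Finset.sum_congr rfl fun j _ ↦ Finset.sum_congr rfl fun k _ ↦ by ring

theorem isCubeBound_inftyOneNorm (A : Matrix (Fin n) (Fin n) ℝ) :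
    IsCubeBound A (inftyOneNorm A) := by
  intro v hv
  have hv' : ‖v‖ ≤ 1 := (pi_norm_le_iff_of_nonneg zero_le_one).2 hv
  refine (le_abs_self _).trans (le_csSup ⟨∑ j, ∑ k, |A j k|, ?_⟩
    ⟨v, v, hv', hv', by rw [mulVec_dotProduct]⟩)
  rintro _ ⟨v, w, hv, hw, rfl⟩
  rw [mulVec_dotProduct]
  refine (Finset.abs_sum_le_sum_abs _ _).trans (Finset.sum_le_sum fun j _ ↦
    (Finset.abs_sum_le_sum_abs _ _).trans (Finset.sum_le_sum fun k _ ↦ ?_))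
  rw [abs_mul, abs_mul]
  exact mul_le_of_le_one_right (abs_nonneg _)
    (mul_le_one₀ ((norm_le_pi_norm w j).trans hw) (abs_nonneg _) ((norm_le_pi_norm v k).trans hv))

theorem pi_div_two_mem_positiveGrothendieckBounds :
    Real.pi / 2 ∈ positiveGrothendieckBounds.{v} :=
  ⟨by positivity, fun _ A hA _ _ _ _ x y hx hy ↦
    (isCubeBound_inftyOneNorm A).abs_sum_mul_inner_le hA x y (fun j ↦ (hx j).le) fun j ↦ (hy j).le⟩

theorem bddAbove_norm_quadPoly (A : Matrix (Fin n) (Fin n) ℂ) :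
    BddAbove {r : ℝ | ∃ z : Fin n → ℂ, (∀ j, ‖z j‖ < 1) ∧ r = ‖quadPoly A z‖} := by
  refine ⟨∑ j, ∑ k, ‖A j k‖, ?_⟩
  rintro _ ⟨z, hz, rfl⟩
  refine norm_sum_le_of_le _ fun j _ ↦ norm_sum_le_of_le _ fun k _ ↦ ?_
  rw [norm_smul, norm_mul]
  exact mul_le_of_le_one_right (norm_nonneg _)
    (mul_le_one₀ (hz j).le (norm_nonneg _) (hz k).le)

/-- The entrywise real part of a complex matrix. -/
def realPart (A : Matrix (Fin n) (Fin n) ℂ) : Matrix (Fin n) (Fin n) ℝ := A.map Complex.re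

theorem posSemidef_realPart {A : Matrix (Fin n) (Fin n) ℂ} (hA : A.PosSemidef) :
    (realPart A).PosSemidef := by
  refine .of_dotProduct_mulVec_nonneg ?_ fun v ↦ ?_
  · ext j k
    simpa [realPart] using congrArg Complex.re (hA.isHermitian.apply j k)
  · have h := (Complex.le_def.1 (hA.dotProduct_mulVec_nonneg fun j ↦ (v j : ℂ))).1
    refine h.trans_eq ?_
    simp [dotProduct, Matrix.mulVec, realPart]

/-- On commuting tuples the polynomial of a Hermitian matrix is that of its real part. -/
theorem quadPoly_eq_realPart {A : Matrix (Fin n) (Fin n) ℂ} (hA : A.IsHermitian) {R : Type*}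
    [Ring R] [Algebra ℂ R] (x : Fin n → R) (hx : ∀ j k, x j * x k = x k * x j) :
    quadPoly A x = ∑ j, ∑ k, (realPart A j k : ℂ) • (x j * x k) := by
  -- Averaging `A` with its transpose leaves the polynomial unchanged and, for Hermitian `A`, gives
  -- the real part.
  have hswap : quadPoly A x = ∑ j, ∑ k, A k j • (x j * x k) := by
    rw [quadPoly, Finset.sum_comm]
    exact Finset.sum_congr rfl fun j _ ↦ Finset.sum_congr rfl fun k _ ↦ by rw [hx]
  have h2 : (2 : ℂ) • quadPoly A x = (2 : ℂ) • ∑ j, ∑ k, (realPart A j k : ℂ) • (x j * x k) := by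
    rw [two_smul]
    nth_rewrite 2 [hswap]
    simp_rw [quadPoly, ← Finset.sum_add_distrib, Finset.smul_sum, smul_smul, ← add_smul]
    refine Finset.sum_congr rfl fun j _ ↦ Finset.sum_congr rfl fun k _ ↦ ?_
    rw [← hA.apply k j]
    simp [realPart, Complex.add_conj]
  exact smul_right_injective R (two_ne_zero (α := ℂ)) h2

/-- The real points `t v` with `t < 1` lie in the open polydisc; let `t → 1`. -/
theorem isCubeBound_polydiscNorm {A : Matrix (Fin n) (Fin n) ℂ} (hA : A.PosSemidef) :
    IsCubeBound (realPart A) (polydiscNorm A) := by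
  intro v hv
  have h (t : ℝ) (ht : t ∈ Set.Ioo (0 : ℝ) 1) :
      t ^ 2 * ∑ j, ∑ k, realPart A j k * (v j * v k) ≤ polydiscNorm A := by
    have hmem : ‖quadPoly A fun j ↦ ((t * v j : ℝ) : ℂ)‖ ≤ polydiscNorm A := by
      refine le_csSup (bddAbove_norm_quadPoly A) ⟨_, fun j ↦ ?_, rfl⟩
      rw [Complex.norm_real, Real.norm_eq_abs, abs_mul, abs_of_pos ht.1]
      exact (mul_le_of_le_one_right ht.1.le (hv j)).trans_lt ht.2
    refine le_trans ?_ ((Complex.re_le_norm _).trans hmem)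
    rw [quadPoly_eq_realPart hA.isHermitian _ fun _ _ ↦ mul_comm _ _]
    simp only [smul_eq_mul, ← Complex.ofReal_mul, ← Complex.ofReal_sum, Complex.ofReal_re,
      Finset.mul_sum]
    refine le_of_eq (Finset.sum_congr rfl fun j _ ↦ Finset.sum_congr rfl fun k _ ↦ by ring)
  have hlim : Tendsto (fun t : ℝ ↦ t ^ 2 * ∑ j, ∑ k, realPart A j k * (v j * v k)) (𝓝[<] 1)
      (𝓝 (1 ^ 2 * ∑ j, ∑ k, realPart A j k * (v j * v k))) :=
    ((continuous_pow 2).mul continuous_const).continuousWithinAt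
  rw [one_pow, one_mul] at hlim
  refine le_of_tendsto hlim ?_
  filter_upwards [Ioo_mem_nhdsLT (zero_lt_one' ℝ)] with t ht using h t ht

theorem norm_quadPoly_le {A : Matrix (Fin n) (Fin n) ℂ} (hA : A.PosSemidef) {H : Type*}
    [NormedAddCommGroup H] [InnerProductSpace ℂ H] [CompleteSpace H] (T : Fin n → H →L[ℂ] H)
    (hT : IsCommutingContractions T) :
    ‖quadPoly A T‖ ≤ Real.pi / 2 * polydiscNorm A := by
  have hB := isCubeBound_polydiscNorm hA
  have h0 : 0 ≤ polydiscNorm A := by simpa using hB 0 (by simp)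
  -- The real part of the inner product makes `H` a real Hilbert space, where Rietz's inequality
  -- applies to `T_j* y` and `T_k x`.
  let _ : InnerProductSpace ℝ H := InnerProductSpace.rclikeToReal ℂ H
  refine ContinuousLinearMap.opNorm_le_of_re_inner_le (by positivity) fun x y hx hy ↦ ?_
  rw [quadPoly_eq_realPart hA.isHermitian T hT.2]
  have h := hB.sum_mul_inner_le (posSemidef_realPart hA)
    (fun j ↦ ContinuousLinearMap.adjoint (T j) y) (fun k ↦ T k x)
    (fun j ↦ ?_) (fun k ↦ ?_)
  · refine le_trans (le_of_eq ?_) h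
    simp only [sum_apply, smul_apply,
      mul_apply_eq_comp, sum_inner, map_sum]
    refine Finset.sum_congr rfl fun j _ ↦ Finset.sum_congr rfl fun k _ ↦ ?_
    rw [real_inner_comm, real_inner_eq_re_inner ℂ, ContinuousLinearMap.adjoint_inner_right,
      inner_smul_left]
    simp
  · refine ((ContinuousLinearMap.adjoint (T j)).le_opNorm y).trans ?_
    rw [hy, mul_one, LinearIsometryEquiv.norm_map]
    exact hT.1 j
  · refine ((T k).le_opNorm x).trans ?_
    rw [hx, mul_one]
    exact hT.1 k

theorem le_pi_div_two_of_mem_C2PlusQuotients {r : ℝ} (hr : r ∈ C2PlusQuotients.{u} n) :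
    r ≤ Real.pi / 2 := by
  obtain ⟨A, -, hA, H, _, _, _, T, hT, rfl⟩ := hr
  have h0 : 0 ≤ polydiscNorm A := by simpa using isCubeBound_polydiscNorm hA 0 (by simp)
  exact div_le_of_le_mul₀ h0 (by positivity) (norm_quadPoly_le hA T hT)

/-! ### Discretised Gaussian kernels -/

section

variable {m ι : Type*} [Fintype m] [Fintype ι]

/-- The matrix `M = ∑ p_j x_j x_jᵀ` has trace `∑ p_j`, and its squared Hilbert–Schmidt norm is the
double sum. Cauchy–Schwarz on the diagonal compares the two. -/
theorem sq_sum_le_card_mul_sum_mul_inner_sq (p : m → ℝ) (x : m → EuclideanSpace ℝ ι)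
    (hx : ∀ j, ‖x j‖ = 1) :
    (∑ j, p j) ^ 2 ≤ Fintype.card ι * ∑ j, ∑ k, p j * p k * ⟪x j, x k⟫ ^ 2 := by
  set M : ι → ι → ℝ := fun a b ↦ ∑ j, p j * (x j a * x j b) with hM
  have htr : ∑ a, M a a = ∑ j, p j := by
    rw [hM, Finset.sum_comm]
    refine Finset.sum_congr rfl fun j _ ↦ ?_
    rw [← Finset.mul_sum]
    have := EuclideanSpace.real_norm_sq_eq (x j)
    rw [hx j] at this
    simp_rw [← pow_two, ← this]
    ring
  have hsq : ∑ j, ∑ k, p j * p k * ⟪x j, x k⟫ ^ 2 = ∑ a, ∑ b, M a b ^ 2 := by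
    have h1 (j k : m) : p j * p k * ⟪x j, x k⟫ ^ 2 =
        ∑ a, ∑ b, p j * (x j a * x j b) * (p k * (x k a * x k b)) := by
      rw [PiLp.inner_apply, pow_two, Finset.sum_mul_sum, Finset.mul_sum]
      refine Finset.sum_congr rfl fun a _ ↦ ?_
      rw [Finset.mul_sum]
      refine Finset.sum_congr rfl fun b _ ↦ ?_
      simp only [RCLike.inner_apply, conj_trivial]
      ring
    simp_rw [h1, hM, pow_two, Finset.sum_mul_sum]
    calc _ = ∑ j, ∑ a, ∑ k, ∑ b, p j * (x j a * x j b) * (p k * (x k a * x k b)) :=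
          Finset.sum_congr rfl fun j _ ↦ Finset.sum_comm
      _ = ∑ a, ∑ j, ∑ k, ∑ b, p j * (x j a * x j b) * (p k * (x k a * x k b)) := Finset.sum_comm
      _ = ∑ a, ∑ j, ∑ b, ∑ k, p j * (x j a * x j b) * (p k * (x k a * x k b)) :=
          Finset.sum_congr rfl fun a _ ↦ Finset.sum_congr rfl fun j _ ↦ Finset.sum_comm
      _ = _ := Finset.sum_congr rfl fun a _ ↦ Finset.sum_comm
  rw [← htr, hsq]
  calc (∑ a, M a a) ^ 2 ≤ Fintype.card ι * ∑ a, M a a ^ 2 := by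
        simpa using sq_sum_le_card_mul_sum_sq (s := Finset.univ) (f := fun a ↦ M a a)
    _ ≤ _ := by
        gcongr with a
        exact Finset.single_le_sum (f := fun b ↦ M a b ^ 2) (fun b _ ↦ sq_nonneg _)
          (Finset.mem_univ a)

end

section

variable {E : Type*} [NormedAddCommGroup E] [InnerProductSpace ℝ E] {m : Type*} [Fintype m]

/-- The weighted Gram matrix `(wⱼ wₖ ⟪vⱼ, vₖ⟫)ⱼₖ`. -/
def weightedGram (w : m → ℝ) (v : m → E) : Matrix m m ℝ :=
  Matrix.of fun j k ↦ w j * w k * ⟪v j, v k⟫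

theorem sum_weightedGram_mul (w : m → ℝ) (v : m → E) (f : m → ℝ) :
    ∑ j, ∑ k, weightedGram w v j k * (f j * f k) = ‖∑ j, (w j * f j) • v j‖ ^ 2 := by
  rw [← real_inner_self_eq_norm_sq]
  simp_rw [sum_inner, inner_sum, real_inner_smul_left, real_inner_smul_right]
  exact Finset.sum_congr rfl fun j _ ↦ Finset.sum_congr rfl fun k _ ↦ by
    rw [weightedGram, Matrix.of_apply]; ring

theorem posSemidef_weightedGram (w : m → ℝ) (v : m → E) : (weightedGram w v).PosSemidef := by
  refine .of_dotProduct_mulVec_nonneg ?_ fun f ↦ ?_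
  · ext j k
    simp [weightedGram, real_inner_comm, mul_comm (w j)]
  · refine (sq_nonneg ‖∑ j, (w j * f j) • v j‖).trans_eq ?_
    rw [← sum_weightedGram_mul]
    simp only [dotProduct, Matrix.mulVec, Finset.mul_sum, star_trivial]
    exact Finset.sum_congr rfl fun j _ ↦ Finset.sum_congr rfl fun k _ ↦ by ring

/-- Duality: the norm of the sum is its pairing with its own direction. -/
theorem norm_sum_le_of_forall_unit (w : m → ℝ) (hw : ∀ j, 0 ≤ w j) (v : m → E) {C : ℝ}
    (hC : 0 ≤ C) (h : ∀ c : E, ‖c‖ = 1 → ∑ j, w j * |⟪c, v j⟫| ≤ C) (f : m → ℝ)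
    (hf : ∀ j, |f j| ≤ 1) : ‖∑ j, (w j * f j) • v j‖ ≤ C := by
  set y := ∑ j, (w j * f j) • v j with hy
  rcases eq_or_ne y 0 with h0 | h0
  · simpa [h0] using hC
  have hy0 : 0 < ‖y‖ := norm_pos_iff.2 h0
  calc ‖y‖ = ⟪‖y‖⁻¹ • y, y⟫ := by
        rw [real_inner_smul_left, real_inner_self_eq_norm_sq]
        field_simp
    _ = ∑ j, w j * (f j * ⟪‖y‖⁻¹ • y, v j⟫) := by
        nth_rewrite 3 [hy]
        simp_rw [inner_sum, real_inner_smul_right, mul_assoc]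
    _ ≤ ∑ j, w j * |⟪‖y‖⁻¹ • y, v j⟫| := by
        refine Finset.sum_le_sum fun j _ ↦ mul_le_mul_of_nonneg_left ?_ (hw j)
        refine (le_abs_self _).trans ?_
        rw [abs_mul]
        exact mul_le_of_le_one_left (abs_nonneg _) (hf j)
    _ ≤ C := h _ (by simp [norm_smul, hy0.ne'])

end

/-- An integrable function is approximated in mean by functions with finitely many values, which
may be labelled by any large enough finite set. -/
theorem exists_measurable_fin_approx {E : Type*} [NormedAddCommGroup E] {Ω : Type*}
    [MeasurableSpace Ω] {μ : Measure Ω}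
    [IsProbabilityMeasure μ] {F : Ω → E} (hF : Integrable F μ) {δ : ℝ} (hδ : 0 < δ) :
    ∃ N : ℕ, ∀ n, N ≤ n → ∃ (φ : Ω → Fin n) (v : Fin n → E), Measurable φ ∧
      ∫ ω, ‖F ω - v (φ ω)‖ ∂μ ≤ δ := by
  classical
  obtain ⟨f, hf, -⟩ := (memLp_one_iff_integrable.2 hF).exists_simpleFunc_eLpNorm_sub_lt
    (by simp) (ε := ENNReal.ofReal δ) (by simpa using hδ)
  refine ⟨f.range.card, fun n hn ↦ ?_⟩
  obtain ⟨e⟩ : Nonempty (f.range ↪ Fin n) :=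
    Function.Embedding.nonempty_of_card_le (by simpa using hn)
  obtain ⟨ω₀⟩ := μ.nonempty_of_neZero
  have : Nonempty (Fin n) := ⟨e ⟨f ω₀, f.mem_range_self ω₀⟩⟩
  -- Spare labels get the value `0`; `v` need not be injective, so a label is chosen for each value.
  set v : Fin n → E := Function.extend e Subtype.val 0 with hv
  have hvf (ω : Ω) : v (Function.invFun v (f ω)) = f ω :=
    Function.invFun_eq ⟨e ⟨f ω, f.mem_range_self ω⟩, e.injective.extend_apply _ _ _⟩
  refine ⟨f.map (Function.invFun v), v, (f.map _).measurable, ?_⟩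
  simp only [SimpleFunc.map_apply, hvf]
  have hint : Integrable (F - ⇑f) μ := hF.sub (f.integrable_of_isFiniteMeasure)
  rw [eLpNorm_one_eq_lintegral_enorm, ← ofReal_integral_norm_eq_lintegral_enorm hint] at hf
  exact ((ENNReal.ofReal_lt_ofReal_iff hδ).1 hf).le

/-- The matrix is the Gram matrix of the values `v_j` of a step function near the identity, weighted
by the masses of its cells. The cube bound comes from `E|⟪c, g⟫| = √(2/π)`, the lower bound from the
trace inequality with `p_j = w_j ‖v_j‖`. The upper bound on `δ` makes squaring monotone. -/
theorem exists_matrix_of_stdGaussian (ι : Type v) [Fintype ι] [Nonempty ι] {δ : ℝ} (hδ : 0 < δ)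
    (hδ' : δ ≤ ∫ g, ‖g‖ ∂stdGaussian (EuclideanSpace ℝ ι)) :
    ∃ N : ℕ, ∀ n, N ≤ n → ∃ A : Matrix (Fin n) (Fin n) ℝ, A.PosSemidef ∧
      IsCubeBound A ((√(2 / Real.pi) + δ) ^ 2) ∧ ∃ x : Fin n → EuclideanSpace ℝ ι,
        (∀ j, ‖x j‖ = 1) ∧
        (∫ g, ‖g‖ ∂stdGaussian (EuclideanSpace ℝ ι) - δ) ^ 2 / Fintype.card ι ≤
          ∑ j, ∑ k, A j k * ⟪x j, x k⟫ := by
  set γ := stdGaussian (EuclideanSpace ℝ ι) with hγ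
  have hid : Integrable (fun g ↦ g) γ := IsGaussian.integrable_id
  obtain ⟨N, hN⟩ := exists_measurable_fin_approx hid hδ
  refine ⟨N, fun n hn ↦ ?_⟩
  obtain ⟨φ, v, hφ, hv⟩ := hN n hn
  set w : Fin n → ℝ := fun j ↦ (γ.map φ).real {j} with hw
  have : IsProbabilityMeasure (γ.map φ) := Measure.isProbabilityMeasure_map hφ.aemeasurable
  have hsum (h : Fin n → ℝ) : ∑ j, w j * h j = ∫ g, h (φ g) ∂γ := by
    rw [← integral_map hφ.aemeasurable (measurable_of_finite h).aestronglyMeasurable,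
      integral_fintype .of_finite]
    rfl
  have hintv : Integrable (fun g ↦ v (φ g)) γ :=
    (Integrable.of_finite (μ := γ.map φ) (f := v)).comp_measurable hφ
  have hdiff : Integrable (fun g ↦ ‖g - v (φ g)‖) γ := (hid.sub hintv).norm
  have hw0 (j : Fin n) : 0 ≤ w j := measureReal_nonneg
  have hunit (c : EuclideanSpace ℝ ι) (hc : ‖c‖ = 1) :
      ∑ j, w j * |⟪c, v j⟫| ≤ √(2 / Real.pi) + δ := by
    rw [hsum fun j ↦ |⟪c, v j⟫|, ← integral_abs_inner_stdGaussian c hc]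
    refine le_trans ?_ (add_le_add_right hv _)
    rw [← integral_add (integrable_inner_stdGaussian c).abs hdiff]
    refine integral_mono (hintv.const_inner c).abs
      ((integrable_inner_stdGaussian c).abs.add hdiff) fun g ↦ ?_
    have h1 : ⟪c, v (φ g)⟫ = ⟪c, g⟫ - ⟪c, g - v (φ g)⟫ := by rw [inner_sub_right]; ring
    have h2 := abs_real_inner_le_norm c (g - v (φ g))
    rw [hc, one_mul] at h2
    simp only [h1]
    exact (abs_sub _ _).trans (by simpa using h2)
  have hmean : ∫ g, ‖g‖ ∂γ - δ ≤ ∑ j, w j * ‖v j‖ := by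
    rw [hsum fun j ↦ ‖v j‖, sub_le_iff_le_add]
    refine le_trans ?_ (add_le_add_right hv _)
    rw [← integral_add hintv.norm hdiff]
    refine integral_mono hid.norm (hintv.norm.add hdiff) fun g ↦ ?_
    exact norm_le_norm_add_norm_sub' g (v (φ g))
  have hdir (j : Fin n) : ∃ x : EuclideanSpace ℝ ι, ‖x‖ = 1 ∧ v j = ‖v j‖ • x := by
    rcases eq_or_ne (v j) 0 with h | h
    · classical
      exact ⟨EuclideanSpace.single (Classical.arbitrary ι) 1, by simp, by simp [h]⟩
    · exact ⟨‖v j‖⁻¹ • v j, by simp [norm_smul, h], by simp [smul_smul, h]⟩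
  choose x hx hvx using hdir
  refine ⟨weightedGram w v, posSemidef_weightedGram w v, fun f hf ↦ ?_, x, hx, ?_⟩
  · rw [sum_weightedGram_mul]
    gcongr
    exact norm_sum_le_of_forall_unit w hw0 v (by positivity) hunit f hf
  · have hd : (0 : ℝ) < Fintype.card ι := by exact_mod_cast Fintype.card_pos
    rw [div_le_iff₀' hd]
    refine (pow_le_pow_left₀ (by linarith) hmean 2).trans
      ((sq_sum_le_card_mul_sum_mul_inner_sq (fun j ↦ w j * ‖v j‖) x hx).trans_eq ?_)
    congr 1
    refine Finset.sum_congr rfl fun j _ ↦ Finset.sum_congr rfl fun k _ ↦ ?_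
    rw [weightedGram, Matrix.of_apply]
    conv_rhs => rw [hvx j, hvx k, real_inner_smul_left, real_inner_smul_right]
    ring

/-! ### Varopoulos' operators -/

section

variable {ι : Type*} [Fintype ι]

/-- Varopoulos' operator on `ℂ ⊕ ℂ^ι ⊕ ℂ`, sending `(a, u, b)` to `(0, a x, ⟪x, u⟫)` for a real
vector `x`. The coordinates `none`, `some (some i)` and `some none` are those of the three
summands. -/
def varopoulosLinear (x : EuclideanSpace ℝ ι) :
    EuclideanSpace ℂ (Option (Option ι)) →ₗ[ℂ] EuclideanSpace ℂ (Option (Option ι)) where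
  toFun u := WithLp.toLp 2 fun
    | none => 0
    | some none => ∑ i, (x i : ℂ) * u (some (some i))
    | some (some i) => (x i : ℂ) * u none
  map_add' u w := by
    ext (_ | _ | i) <;> simp [mul_add, Finset.sum_add_distrib]
  map_smul' c u := by
    ext (_ | _ | i) <;> simp [Finset.mul_sum, mul_left_comm]

theorem norm_varopoulosLinear_le (x : EuclideanSpace ℝ ι) (hx : ‖x‖ ≤ 1)
    (u : EuclideanSpace ℂ (Option (Option ι))) : ‖varopoulosLinear x u‖ ≤ 1 * ‖u‖ := by
  have hx2 : ∑ i, x i ^ 2 ≤ 1 := by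
    rw [← EuclideanSpace.real_norm_sq_eq]
    exact pow_le_one₀ (norm_nonneg _) hx
  rw [one_mul]
  refine le_of_sq_le_sq ?_ (norm_nonneg _)
  rw [EuclideanSpace.norm_sq_eq, EuclideanSpace.norm_sq_eq]
  simp only [Fintype.sum_option, varopoulosLinear, LinearMap.coe_mk, AddHom.coe_mk, norm_zero,
    norm_mul, Complex.norm_real, mul_pow, ← Finset.sum_mul, Real.norm_eq_abs, sq_abs]
  have h1 : ‖∑ i, (x i : ℂ) * u (some (some i))‖ ^ 2 ≤ ∑ i, ‖u (some (some i))‖ ^ 2 := by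
    calc _ ≤ (∑ i, |x i| * ‖u (some (some i))‖) ^ 2 := by
          gcongr
          refine norm_sum_le_of_le _ fun i _ ↦ ?_
          rw [norm_mul, Complex.norm_real, Real.norm_eq_abs]
      _ ≤ (∑ i, |x i| ^ 2) * ∑ i, ‖u (some (some i))‖ ^ 2 := Finset.sum_mul_sq_le_sq_mul_sq _ _ _
      _ ≤ _ := by
          simp_rw [sq_abs]
          exact mul_le_of_le_one_left (by positivity) hx2
  have h2 : (∑ i, x i ^ 2) * ‖u none‖ ^ 2 ≤ ‖u none‖ ^ 2 :=
    mul_le_of_le_one_left (by positivity) hx2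
  have h3 : 0 ≤ ‖u (some none)‖ ^ 2 := by positivity
  linarith

/-- Varopoulos' operator as a contraction, for a vector `x` of the unit ball. -/
noncomputable def varopoulos (x : EuclideanSpace ℝ ι) (hx : ‖x‖ ≤ 1) :
    EuclideanSpace ℂ (Option (Option ι)) →L[ℂ] EuclideanSpace ℂ (Option (Option ι)) :=
  (varopoulosLinear x).mkContinuous 1 (norm_varopoulosLinear_le x hx)

theorem norm_varopoulos_le (x : EuclideanSpace ℝ ι) (hx : ‖x‖ ≤ 1) : ‖varopoulos x hx‖ ≤ 1 :=
  LinearMap.mkContinuous_norm_le _ zero_le_one _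

/-- The product depends on `x` and `y` only through `⟪x, y⟫`. Its symmetry makes the operators
commute, and `p_A` becomes a scalar multiple of one fixed operator. -/
theorem varopoulos_mul_apply [DecidableEq ι] (x y : EuclideanSpace ℝ ι) (hx : ‖x‖ ≤ 1)
    (hy : ‖y‖ ≤ 1) (u : EuclideanSpace ℂ (Option (Option ι))) :
    (varopoulos x hx * varopoulos y hy) u =
      EuclideanSpace.single (some none) ((⟪x, y⟫ : ℂ) * u none) := by
  ext (_ | _ | i)
  · simp [varopoulos, varopoulosLinear]
  · simp [varopoulos, varopoulosLinear, PiLp.inner_apply, Finset.sum_mul, mul_assoc, mul_left_comm]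
  · simp [varopoulos, varopoulosLinear]

theorem isCommutingContractions_varopoulos {n : ℕ} (x : Fin n → EuclideanSpace ℝ ι)
    (hx : ∀ j, ‖x j‖ ≤ 1) : IsCommutingContractions fun j ↦ varopoulos (x j) (hx j) := by
  classical
  refine ⟨fun j ↦ norm_varopoulos_le _ _, fun j k ↦ ?_⟩
  ext1 u
  rw [varopoulos_mul_apply, varopoulos_mul_apply, real_inner_comm]

theorem le_norm_quadPoly_varopoulos {n : ℕ} (A : Matrix (Fin n) (Fin n) ℝ)
    (x : Fin n → EuclideanSpace ℝ ι) (hx : ∀ j, ‖x j‖ ≤ 1) :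
    ∑ j, ∑ k, A j k * ⟪x j, x k⟫ ≤
      ‖quadPoly (A.map Complex.ofReal) fun j ↦ varopoulos (x j) (hx j)‖ := by
  classical
  set e : EuclideanSpace ℂ (Option (Option ι)) := EuclideanSpace.single none 1 with he
  have h1 : (quadPoly (A.map Complex.ofReal) fun j ↦ varopoulos (x j) (hx j)) e =
      EuclideanSpace.single (some none) ((∑ j, ∑ k, A j k * ⟪x j, x k⟫ : ℝ) : ℂ) := by
    simp only [quadPoly, sum_apply, smul_apply, varopoulos_mul_apply]
    ext (_ | _ | i) <;> simp [he]
  have h2 := (quadPoly (A.map Complex.ofReal) fun j ↦ varopoulos (x j) (hx j)).le_opNorm e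
  rw [h1, he] at h2
  simp only [PiLp.norm_single, Complex.norm_real, norm_one, mul_one] at h2
  exact (le_abs_self _).trans h2

end

/-! ### Norms controlled by the cube bound -/

section

variable {n : ℕ} {A : Matrix (Fin n) (Fin n) ℝ} {B : ℝ}

theorem posSemidef_map_ofReal (hA : A.PosSemidef) : (A.map Complex.ofReal).PosSemidef := by
  obtain ⟨N, v, rfl⟩ := Matrix.posSemidef_iff_eq_sum_vecMulVec.1 hA
  refine Matrix.posSemidef_iff_eq_sum_vecMulVec.2 ⟨N, fun i j ↦ (v i j : ℂ), ?_⟩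
  ext j k
  simp [Matrix.sum_apply, Matrix.vecMulVec_apply]

/-- The real part is the form at `Re z` minus the form at `Im z`, and the latter is nonnegative. -/
theorem IsCubeBound.re_quadPoly_le (hB : IsCubeBound A B) (hA : A.PosSemidef) (z : Fin n → ℂ)
    (hz : ∀ j, ‖z j‖ ≤ 1) : (quadPoly (A.map Complex.ofReal) z).re ≤ B := by
  have h1 := hB (fun j ↦ (z j).re) fun j ↦ (Complex.abs_re_le_norm _).trans (hz j)
  have h2 := hA.sum_mul_nonneg fun j ↦ (z j).im
  have h3 : (quadPoly (A.map Complex.ofReal) z).re =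
      ∑ j, ∑ k, A j k * ((z j).re * (z k).re) - ∑ j, ∑ k, A j k * ((z j).im * (z k).im) := by
    simp [quadPoly, ← Finset.sum_sub_distrib, mul_sub]
  linarith

theorem IsCubeBound.polydiscNorm_le (hB : IsCubeBound A B) (hA : A.PosSemidef) :
    polydiscNorm (A.map Complex.ofReal) ≤ B := by
  refine csSup_le ⟨_, 0, by simp, rfl⟩ ?_
  rintro _ ⟨z, hz, rfl⟩
  set p := quadPoly (A.map Complex.ofReal) z with hp
  -- Since `p_A` has degree two, rotating `z` by half the argument of `p` makes the value real and
  -- nonnegative.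
  set θ : ℂ := Complex.exp ((-(p.arg / 2) : ℝ) * Complex.I) with hθ
  have hrot : quadPoly (A.map Complex.ofReal) (fun j ↦ θ * z j) = ‖p‖ := by
    have h1 : quadPoly (A.map Complex.ofReal) (fun j ↦ θ * z j) = θ ^ 2 * p := by
      simp only [hp, quadPoly, Finset.mul_sum, smul_eq_mul]
      exact Finset.sum_congr rfl fun j _ ↦ Finset.sum_congr rfl fun k _ ↦ by ring
    rw [h1]
    nth_rewrite 1 [← Complex.norm_mul_exp_arg_mul_I p]
    rw [hθ, ← Complex.exp_nat_mul, mul_left_comm, ← Complex.exp_add]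
    have : ((2 : ℕ) : ℂ) * ((-(p.arg / 2) : ℝ) * Complex.I) + p.arg * Complex.I = 0 := by
      push_cast; ring
    rw [this, Complex.exp_zero, mul_one]
  have h := hB.re_quadPoly_le hA (fun j ↦ θ * z j) fun j ↦ by
    rw [norm_mul, hθ, Complex.norm_exp_ofReal_mul_I, one_mul]
    exact (hz j).le
  rwa [hrot, Complex.ofReal_re] at h

theorem IsCubeBound.sum_mul_le (hB : IsCubeBound A B) (hA : A.PosSemidef) (v w : Fin n → ℝ)
    (hv : ∀ j, |v j| ≤ 1) (hw : ∀ j, |w j| ≤ 1) : ∑ j, ∑ k, A j k * (v j * w k) ≤ B := by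
  have h0 := hA.sum_mul_nonneg fun j ↦ v j - w j
  have h1 := hB v hv
  have h2 := hB w hw
  have hsymm : ∑ j, ∑ k, A j k * (w j * v k) = ∑ j, ∑ k, A j k * (v j * w k) := by
    rw [Finset.sum_comm]
    refine Finset.sum_congr rfl fun j _ ↦ Finset.sum_congr rfl fun k _ ↦ ?_
    rw [mul_comm (w k), ← hA.isHermitian.apply j k, star_trivial]
  simp_rw [sub_mul, mul_sub, Finset.sum_sub_distrib] at h0
  linarith

theorem IsCubeBound.inftyOneNorm_le (hB : IsCubeBound A B) (hA : A.PosSemidef) :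
    inftyOneNorm A ≤ B := by
  refine csSup_le ⟨_, 0, 0, by simp, by simp, rfl⟩ ?_
  rintro _ ⟨v, w, hv, hw, rfl⟩
  rw [mulVec_dotProduct]
  have hv' (j : Fin n) : |v j| ≤ 1 := (norm_le_pi_norm v j).trans hv
  have hw' (j : Fin n) : |w j| ≤ 1 := (norm_le_pi_norm w j).trans hw
  refine abs_le'.2 ⟨hB.sum_mul_le hA w v hw' hv', ?_⟩
  have := hB.sum_mul_le hA w (fun j ↦ -v j) hw' (by simpa using hv')
  simpa using this

end

/-! ### Optimality of the constant and the limit -/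

theorem tendsto_lower_bound (C : ℝ) :
    Tendsto (fun d : ℕ ↦ (1 - (C + 1) / (d : ℝ)) ^ 2 / (√(2 / Real.pi) + 1 / (d : ℝ)) ^ 2) atTop
      (𝓝 (Real.pi / 2)) := by
  have hlim : Real.pi / 2 = (1 - 0) ^ 2 / (√(2 / Real.pi) + 0) ^ 2 := by
    rw [add_zero, Real.sq_sqrt (by positivity)]
    simp
  rw [hlim]
  refine ((tendsto_const_nhds.sub (tendsto_const_div_atTop_nhds_zero_nat _)).pow 2).div
    ((tendsto_const_nhds.add (tendsto_const_div_atTop_nhds_zero_nat _)).pow 2) ?_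
  rw [add_zero, Real.sq_sqrt (by positivity)]
  positivity

/-- The constant `π / 2` in the positive Grothendieck inequality is optimal, with matrices of every
sufficiently large size. -/
theorem exists_matrix_lt_sum_mul_inner {r : ℝ} (hr : r < Real.pi / 2) :
    ∃ (ι : Type v) (_ : Fintype ι) (N : ℕ), ∀ n, N ≤ n → ∃ (A : Matrix (Fin n) (Fin n) ℝ) (B : ℝ),
      A.PosSemidef ∧ 0 < B ∧ IsCubeBound A B ∧ ∃ x : Fin n → EuclideanSpace ℝ ι,
        (∀ j, ‖x j‖ = 1) ∧ r * B < ∑ j, ∑ k, A j k * ⟪x j, x k⟫ := by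
  obtain ⟨C, hC⟩ := exists_le_integral_norm_stdGaussian.{v}
  -- The condition `d ≥ C + 1` keeps `1 - (C + 1)/d` nonnegative, so that it may be squared.
  obtain ⟨d, hd, hdC, hd0⟩ := (((tendsto_lower_bound C).eventually (lt_mem_nhds hr)).and
    ((tendsto_natCast_atTop_atTop.eventually_ge_atTop (C + 1)).and (eventually_ge_atTop 1))).exists
  have hd1 : (1 : ℝ) ≤ d := by exact_mod_cast hd0
  have : Nonempty (Fin d) := ⟨⟨0, hd0⟩⟩
  have hI := hC (ULift.{v} (Fin d))
  rw [Fintype.card_ulift, Fintype.card_fin] at hI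
  set I := ∫ g, ‖g‖ ∂stdGaussian (EuclideanSpace ℝ (ULift.{v} (Fin d))) with hIdef
  have hsd : 1 ≤ √(d : ℝ) := Real.one_le_sqrt.2 hd1
  -- Raising `C` to `C + 1` absorbs the discretisation error `1/d`, because `√d ≥ 1`.
  have hI' : √(d : ℝ) * (1 - (C + 1) / d) ≤ I - 1 / d := by
    have h1 : √(d : ℝ) * (1 - (C + 1) / d) = √(d : ℝ) * (1 - C / d) - √(d : ℝ) * (1 / d) := by
      ring
    have h2 : 1 * (1 / (d : ℝ)) ≤ √(d : ℝ) * (1 / d) := by gcongr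
    linarith
  have h0 : 0 ≤ 1 - (C + 1) / (d : ℝ) := sub_nonneg.2 ((div_le_one (by linarith)).2 hdC)
  obtain ⟨N, hN⟩ := exists_matrix_of_stdGaussian (ULift.{v} (Fin d)) (δ := 1 / (d : ℝ))
    (by positivity) (by
      rw [← hIdef, ← sub_nonneg]
      exact (by positivity : 0 ≤ √(d : ℝ) * (1 - (C + 1) / d)).trans hI')
  refine ⟨ULift.{v} (Fin d), inferInstance, N, fun n hn ↦ ?_⟩
  obtain ⟨A, hA, hB, x, hx, hval⟩ := hN n hn
  have hB0 : 0 < (√(2 / Real.pi) + 1 / (d : ℝ)) ^ 2 := by positivity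
  refine ⟨A, _, hA, hB0, hB, x, hx, ((lt_div_iff₀ hB0).1 hd).trans_le (le_trans ?_ hval)⟩
  rw [Fintype.card_ulift, Fintype.card_fin, le_div_iff₀ (by positivity), ← hIdef]
  calc (1 - (C + 1) / (d : ℝ)) ^ 2 * d = (√(d : ℝ) * (1 - (C + 1) / d)) ^ 2 := by
        rw [mul_pow, Real.sq_sqrt (by positivity), mul_comm]
    _ ≤ (I - 1 / d) ^ 2 := by gcongr

theorem pi_div_two_le_of_mem_positiveGrothendieckBounds {K : ℝ}
    (hK : K ∈ positiveGrothendieckBounds.{v}) : Real.pi / 2 ≤ K := by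
  refine le_of_forall_lt fun r hr ↦ ?_
  obtain ⟨ι, _, N, hN⟩ := exists_matrix_lt_sum_mul_inner.{v} hr
  obtain ⟨A, B, hA, hB0, hB, x, hx, hlt⟩ := hN N le_rfl
  have h1 := (le_abs_self _).trans (hK.2 N A hA (EuclideanSpace ℝ ι) x x hx hx)
  have h2 : K * inftyOneNorm A ≤ K * B :=
    mul_le_mul_of_nonneg_left (hB.inftyOneNorm_le hA) hK.1.le
  exact lt_of_mul_lt_mul_right (hlt.trans_le (h1.trans h2)) hB0.le

theorem bddAbove_C2PlusQuotients (n : ℕ) : BddAbove (C2PlusQuotients.{u} n) :=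
  ⟨Real.pi / 2, fun _ ↦ le_pi_div_two_of_mem_C2PlusQuotients⟩

theorem C2Plus_le (n : ℕ) : C2Plus.{u} n ≤ Real.pi / 2 :=
  -- For `n = 0` there is no nonzero matrix; the supremum of the empty set is `0`.
  Real.sSup_le (fun _ ↦ le_pi_div_two_of_mem_C2PlusQuotients) (by positivity)

theorem eventually_lt_C2Plus {r : ℝ} (hr0 : 0 ≤ r) (hr : r < Real.pi / 2) :
    ∀ᶠ n in atTop, r < C2Plus.{u} n := by
  obtain ⟨ι, _, N, hN⟩ := exists_matrix_lt_sum_mul_inner.{u} hr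
  filter_upwards [eventually_ge_atTop N] with n hn
  obtain ⟨A, B, hA, hB0, hB, x, hx, hlt⟩ := hN n hn
  have hA' := posSemidef_map_ofReal hA
  have hT := isCommutingContractions_varopoulos x fun j ↦ (hx j).le
  have hle := le_norm_quadPoly_varopoulos A x fun j ↦ (hx j).le
  have hpos : 0 < ∑ j, ∑ k, A j k * ⟪x j, x k⟫ := (mul_nonneg hr0 hB0.le).trans_lt hlt
  have hne : A.map Complex.ofReal ≠ 0 := by
    intro h
    have : A = 0 := by
      ext j k
      simpa using congrFun₂ h j k
    simp [this] at hpos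
  have hup := norm_quadPoly_le hA' _ hT
  -- The upper bound itself excludes a zero denominator, as `p_A(T) ≠ 0`.
  have hnorm : 0 < polydiscNorm (A.map Complex.ofReal) :=
    pos_of_mul_pos_right ((hpos.trans_le hle).trans_le hup) (by positivity)
  refine lt_of_lt_of_le ?_ (le_csSup (bddAbove_C2PlusQuotients n)
    ⟨A.map Complex.ofReal, hne, hA', _, _, _, inferInstance, _, hT, rfl⟩)
  rw [lt_div_iff₀ hnorm]
  calc r * polydiscNorm (A.map Complex.ofReal) ≤ r * B :=
        mul_le_mul_of_nonneg_left (hB.polydiscNorm_le hA) hr0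
    _ < _ := hlt.trans_le hle

theorem tendsto_C2Plus : Tendsto (fun n : ℕ ↦ C2Plus.{u} n) atTop (𝓝 (Real.pi / 2)) := by
  refine tendsto_order.2 ⟨fun r hr ↦ ?_, fun r hr ↦ .of_forall fun n ↦ (C2Plus_le n).trans_lt hr⟩
  -- Replacing `r` by `max r 0` supplies the sign needed to multiply the bound on the polydisc norm.
  filter_upwards [eventually_lt_C2Plus.{u} (le_max_right r 0) (max_lt hr (by positivity))] with n hn
  exact (le_max_left r 0).trans_lt hn

end PositiveGrothendieck

theorem mainTheorem1 :
    (∀ n : ℕ, BddAbove (C2PlusQuotients.{u} n)) ∧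
      Tendsto (fun n : ℕ => C2Plus.{u} n) atTop (𝓝 (Real.pi / 2)) ∧
      IsLeast positiveGrothendieckBounds.{v} (Real.pi / 2) :=
  ⟨PositiveGrothendieck.bddAbove_C2PlusQuotients, PositiveGrothendieck.tendsto_C2Plus,
    PositiveGrothendieck.pi_div_two_mem_positiveGrothendieckBounds,
    fun _ ↦ PositiveGrothendieck.pi_div_two_le_of_mem_positiveGrothendieckBounds⟩
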